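/- Let $S:[0,1)\to[0,1)$ be an interval translation map: there are $0=t_0<t_1<\dots<t_n=1$ and reals $c_1,\dots,c_n$ with $0\le t_{k-1}+c_k<t_k+c_k\le 1$ such that $S(x)=x+c_k$ for $x\in[t_{k-1},t_k)$. Call a non-degenerate interval $J\subset[0,1)$ rigid if every iterate $S^m|_J$ is continuous. Then the set $\{\mu_1,\dots,\mu_k\}$ of non-atomic ergodic $S$-invariant Borel probability measures is finite. Put $\mu_{na}=\frac1k\sum_{j=1}^k\mu_j$ (and $\mu_{na}=0$ if $k=0$). Let $\mu_{per}$ be normalized Lebesgue measure on the union of the rigid intervals that consist of periodic points of $S$ (and $\mu_{per}=0$ if there are none). Define the maximal measure by $\mu^*=\frac12(\mu_{na}+\mu_{per})$ if $S$ has a periodic point, and $\mu^*=\mu_{na}$ otherwise. 1. For every $S$-invariant Borel probability measure $\mu$ one has $\operatorname{supp}\mu\subset\operatorname{supp}\mu^*$. 2. For every non-atomic $S$-invariant Borel probability measure $\mu$, the support of the restriction of $\mu$ to the set of non-periodic points of $S$ is contained in $\operatorname{supp}\mu_{na}$; in particular $\operatorname{supp}\mu\subset\operatorname{supp}\mu_{na}$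 if the set of periodic points has $\mu$-measure zero. -/

import Mathlib

open MeasureTheory Set Function
open scoped ENNReal

/-- `S : [0,1) → [0,1)` is an interval translation map: there are `0 = t₀ < t₁ < ⋯ < tₙ = 1` and
real numbers `c₁, …, cₙ` with `0 ≤ tₖ₋₁ + cₖ` and `tₖ + cₖ ≤ 1` such that `S x = x + cₖ` for all
`x ∈ [tₖ₋₁, tₖ)`. (Here `k` runs through `Fin n`, starting from `0`.) -/
def IsITM (S : Ico (0 : ℝ) 1 → Ico (0 : ℝ) 1) : Prop :=
  ∃ (n : ℕ) (t : Fin (n + 1) → ℝ) (c : Fin n → ℝ),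
    t 0 = 0 ∧ t (Fin.last n) = 1 ∧ StrictMono t ∧
    (∀ k : Fin n, 0 ≤ t k.castSucc + c k ∧ t k.succ + c k ≤ 1) ∧
    ∀ (k : Fin n) (x : Ico (0 : ℝ) 1), (x : ℝ) ∈ Ico (t k.castSucc) (t k.succ) →
      (S x : ℝ) = x + c k

/-- `J` is a rigid segment of `S`: a non-degenerate interval (open, closed or half-open) in `[0,1)`
on which every iterate of `S` is continuous. -/
def IsRigid (S : Ico (0 : ℝ) 1 → Ico (0 : ℝ) 1) (J : Set (Ico (0 : ℝ) 1)) : Prop :=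
  J.OrdConnected ∧ J.Nontrivial ∧ ∀ m : ℕ, ContinuousOn S^[m] J

/-- The union of the rigid segments of `S` that consist of periodic points. -/
def rigidUnion (S : Ico (0 : ℝ) 1 → Ico (0 : ℝ) 1) : Set (Ico (0 : ℝ) 1) :=
  ⋃₀ {J | IsRigid S J ∧ J ⊆ periodicPts S}

/-- The non-atomic ergodic `S`-invariant Borel probability measures. -/
def nonatomicErgodic (S : Ico (0 : ℝ) 1 → Ico (0 : ℝ) 1) : Set (Measure (Ico (0 : ℝ) 1)) :=
  {μ | IsProbabilityMeasure μ ∧ NullSingletonClass μ ∧ Ergodic S μ}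

/-- The maximal non-atomic measure: the arithmetic mean of the non-atomic ergodic probability
measures. It is zero if there are none, as every multiple of the zero measure is zero. -/
noncomputable def maximalNonatomic (S : Ico (0 : ℝ) 1 → Ico (0 : ℝ) 1) :
    Measure (Ico (0 : ℝ) 1) :=
  ((nonatomicErgodic S).ncard : ℝ≥0∞)⁻¹ • ∑ᶠ μ ∈ nonatomicErgodic S, μ

/-- Lebesgue measure on `[0,1)`. -/
noncomputable def lebesgueIco : Measure (Ico (0 : ℝ) 1) :=
  (volume : Measure ℝ).comap Subtype.val

/-- The periodic measure: normalized Lebesgue measure on the union of the rigid segments. It is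
zero if there are none. -/
noncomputable def periodicMeasure (S : Ico (0 : ℝ) 1 → Ico (0 : ℝ) 1) :
    Measure (Ico (0 : ℝ) 1) :=
  (lebesgueIco (rigidUnion S))⁻¹ • lebesgueIco.restrict (rigidUnion S)

open Classical in
/-- The maximal measure: the mean of the maximal non-atomic measure and the periodic measure if
`S` has a periodic point, and the maximal non-atomic measure otherwise. -/
noncomputable def maximalMeasure (S : Ico (0 : ℝ) 1 → Ico (0 : ℝ) 1) :
    Measure (Ico (0 : ℝ) 1) :=
  if (periodicPts S).Nonempty then
    (2 : ℝ≥0∞)⁻¹ • (maximalNonatomic S + periodicMeasure S)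
  else maximalNonatomic S

/-!
The heart of the matter is that invariant measures without mass on the periodic points span a
finite-dimensional space, of dimension at most `2 * n` if `S` has `n` pieces.

Fix a small `η` and consider the `2 * n` one-sided neighbourhoods of width `η` of the left end
points of the pieces (`sideNhd`). Any set of diameter less than `η` moves by translations until it
is first cut by a division point, and then all of it lies in the union of these neighbourhoods
(`HasPieces.iterate_cutTime_mem_sideNhd`). An interval that is never cut consists of eventually
periodic points (`HasPieces.exists_iterate_mem_periodicPts`). Hence, after a bounded time, an
orbit that is not eventually periodic is a concatenation of segments, each of which shadows one of
`2 * n` fixed orbit segments within `η`. So if the sums of a function `g` over these `2 * n`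
segments vanish, the Birkhoff averages of `g` are asymptotically at most the oscillation of `g` at
scale `η`, and so is `∫ g dμ` (`HasPieces.exists_abs_birkhoffSum_le`). Given more than `2 * n`
measures carried by sets that are null for each other, some nontrivial combination `g` of functions
separating them has vanishing segment sums, which is absurd (`HasPieces.card_le`). No injectivity
of `S`, ergodic theorem or complexity bound is needed.

Non-atomic ergodic measures do not charge the periodic points and are mutually singular, so they
are finite in number. Moreover an invariant measure `ν` without periodic mass is absolutely
continuous with respect to the maximal non-atomic measure: a set charged by `ν` is charged by an
ergodic conditional measure of `ν`, since otherwise invariant sets of positive measure could be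
split off forever, against the bound (`IsITM.exists_ergodic_cond`). This applies to the restriction
of any invariant measure to the non-periodic points. As `S` is a translation to the right of every
point, points slightly to the right of a periodic point are periodic too and form a rigid interval
(`IsITM.exists_rigid_Ico`), so that the periodic measure charges every neighbourhood of every
periodic point.
-/

/-! ### Pieces, cut times and one-sided neighbourhoods -/

/-- `t` and `c` are division points and translation lengths for `S`: on the piece
`[tₖ, tₖ₊₁)`, `k : Fin n`, the map `S` is the translation by `cₖ`. -/
structure HasPieces (S : Ico (0 : ℝ) 1 → Ico (0 : ℝ) 1) {n : ℕ} (t : Fin (n + 1) → ℝ)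
    (c : Fin n → ℝ) : Prop where
  zero : t 0 = 0
  last : t (Fin.last n) = 1
  mono : StrictMono t
  map_eq : ∀ (k : Fin n) (x : Ico (0 : ℝ) 1), (x : ℝ) ∈ Ico (t k.castSucc) (t k.succ) →
    (S x : ℝ) = x + c k

theorem IsITM.exists_hasPieces {S : Ico (0 : ℝ) 1 → Ico (0 : ℝ) 1} (hS : IsITM S) :
    ∃ (n : ℕ) (t : Fin (n + 1) → ℝ) (c : Fin n → ℝ), HasPieces S t c := by
  obtain ⟨n, t, c, h0, h1, hm, -, h⟩ := hS
  exact ⟨n, t, c, h0, h1, hm, h⟩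

/-- The set `A` lies in a single piece `[tₖ, tₖ₊₁)` of the partition with division points `t`. -/
def InPiece {n : ℕ} (t : Fin (n + 1) → ℝ) (A : Set (Ico (0 : ℝ) 1)) : Prop :=
  ∃ k : Fin n, ∀ x ∈ A, (x : ℝ) ∈ Ico (t k.castSucc) (t k.succ)

/-- The cut time of `A`: the first `j` for which `S^[j] '' A` meets two different pieces, and `0`
if there is no such `j`. Up to this time `A` moves by translations. -/
noncomputable def cutTime (S : Ico (0 : ℝ) 1 → Ico (0 : ℝ) 1) {n : ℕ} (t : Fin (n + 1) → ℝ)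
    (A : Set (Ico (0 : ℝ) 1)) : ℕ :=
  sInf {j | ¬ InPiece t (S^[j] '' A)}

/-- The one-sided neighbourhood of `d` of width `η` in `[0,1)`: the right one `[d, d + η)` for
`true`, and the left one `[d - η, d)` for `false`. -/
def sideNhd (d η : ℝ) : Bool → Set (Ico (0 : ℝ) 1)
  | true => {x | d ≤ x ∧ (x : ℝ) < d + η}
  | false => {x | d - η ≤ x ∧ (x : ℝ) < d}

section Pieces

variable {S : Ico (0 : ℝ) 1 → Ico (0 : ℝ) 1} {n : ℕ} {t : Fin (n + 1) → ℝ} {c : Fin n → ℝ}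

theorem HasPieces.exists_piece (h : HasPieces S t c) (x : Ico (0 : ℝ) 1) :
    ∃ k : Fin n, (x : ℝ) ∈ Ico (t k.castSucc) (t k.succ) := by
  by_contra! hx
  have key : ∀ i : Fin (n + 1), t i ≤ x := by
    intro i
    induction i using Fin.induction with
    | zero => rw [h.zero]; exact x.2.1
    | succ k ih =>
      by_contra! hk
      exact hx k ⟨ih, hk⟩
  have := key (Fin.last n)
  rw [h.last] at this
  exact absurd x.2.2 (not_lt.2 this)

/-- As long as the images of `A` lie in single pieces, the iterates act on `A` by translations. -/
theorem HasPieces.exists_translation (h : HasPieces S t c) {A : Set (Ico (0 : ℝ) 1)} {m : ℕ}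
    (hA : ∀ j < m, InPiece t (S^[j] '' A)) :
    ∃ a : ℝ, ∀ x ∈ A, (S^[m] x : ℝ) = x + a := by
  induction m with
  | zero => exact ⟨0, fun x _ => by simp⟩
  | succ m ih =>
    obtain ⟨a, ha⟩ := ih fun j hj => hA j (by omega)
    obtain ⟨k, hk⟩ := hA m (by omega)
    refine ⟨a + c k, fun x hx => ?_⟩
    rw [iterate_succ_apply', h.map_eq k _ (hk _ (mem_image_of_mem _ hx)), ha x hx]
    ring

/-- A non-degenerate interval that is never cut consists of eventually periodic points: two of its
translates overlap, so the translation by their difference `a` can be repeated forever inside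
`[0,1)`, and therefore `a = 0`. -/
theorem HasPieces.exists_iterate_mem_periodicPts (h : HasPieces S t c) {A : Set (Ico (0 : ℝ) 1)}
    {u v : ℝ} (huv : u < v) (hu : 0 ≤ u) (hv : v ≤ 1)
    (hA : ∀ x : Ico (0 : ℝ) 1, u ≤ x → (x : ℝ) < v → x ∈ A)
    (hcut : ∀ j, InPiece t (S^[j] '' A)) :
    ∀ x ∈ A, ∃ m, S^[m] x ∈ periodicPts S := by
  have htr : ∀ m, ∃ a : ℝ, ∀ x ∈ A, (S^[m] x : ℝ) = x + a :=
    fun m => h.exists_translation fun j _ => hcut j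
  choose a ha using htr
  -- two points of `A` at any prescribed distance less than `v - u`
  have hpair : ∀ b : ℝ, |b| < v - u → ∃ x ∈ A, ∃ y ∈ A, (y : ℝ) = x + b := by
    intro b hb
    rw [abs_lt] at hb
    rcases le_total 0 b with hb0 | hb0
    · exact ⟨⟨u, by constructor <;> linarith⟩, hA _ le_rfl (by simpa using huv),
        ⟨u + b, by constructor <;> linarith⟩, hA _ (by simpa using hb0) (by simp; linarith), rfl⟩
    · exact ⟨⟨u - b, by constructor <;> linarith⟩, hA _ (by simpa using hb0) (by simp; linarith),
        ⟨u, by constructor <;> linarith⟩, hA _ le_rfl (by simpa using huv), by simp⟩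
  obtain ⟨x₀, hx₀, -⟩ := hpair 0 (by simpa using huv)
  have hbd : ∀ m, a m ∈ Icc (-1 : ℝ) 1 := fun m => by
    have h1 := ha m x₀ hx₀
    have h2 := (S^[m] x₀).2
    have h3 := x₀.2
    rw [mem_Ico] at h2 h3
    constructor <;> linarith
  -- two of the translates overlap
  obtain ⟨i, j, hij, hd⟩ : ∃ i j, i < j ∧ |a j - a i| < v - u := by
    obtain ⟨b, -, φ, hφ, hlim⟩ := isCompact_Icc.tendsto_subseq hbd
    obtain ⟨N, hN⟩ := Metric.cauchySeq_iff.1 hlim.cauchySeq (v - u) (by linarith)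
    refine ⟨φ N, φ (N + 1), hφ (by omega), ?_⟩
    have := hN (N + 1) (by omega) N le_rfl
    rwa [Real.dist_eq] at this
  obtain ⟨x, hx, y, hy, hxy⟩ := hpair _ hd
  set p := j - i with hp
  have hstep : ∀ k, a (i + (k + 1) * p) = a (i + k * p) + (a j - a i) := by
    intro k
    induction k with
    | zero =>
      have : i + (0 + 1) * p = j := by omega
      rw [this]; simp
    | succ k ih =>
      have h1 : S^[i + (k + 1) * p] x = S^[i + k * p] y := by
        apply Subtype.ext
        rw [ha _ x hx, ha _ y hy, ih, hxy]; ring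
      have h2 : S^[i + (k + 1 + 1) * p] x = S^[i + (k + 1) * p] y := by
        have e1 : i + (k + 1 + 1) * p = p + (i + (k + 1) * p) := by ring
        have e2 : i + (k + 1) * p = p + (i + k * p) := by ring
        rw [e1, iterate_add_apply, h1, ← iterate_add_apply, e2]
      have h3 := congrArg Subtype.val h2
      rw [ha _ x hx, ha _ y hy, hxy] at h3
      linarith
  have hmul : ∀ k : ℕ, a (i + k * p) = a i + k * (a j - a i) := by
    intro k
    induction k with
    | zero => simp
    | succ k ih => rw [hstep, ih]; push_cast; ring
  have hzero : a j - a i = 0 := by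
    by_contra hne
    obtain ⟨k, hk⟩ := exists_nat_gt (2 / |a j - a i|)
    have hpos : 0 < |a j - a i| := abs_pos.2 hne
    rw [div_lt_iff₀ hpos] at hk
    have h1 := hmul k
    have h2 := hbd (i + k * p)
    have h3 := hbd i
    have h4 : (k : ℝ) * |a j - a i| = |a (i + k * p) - a i| := by
      rw [h1, add_sub_cancel_left, abs_mul, Nat.abs_cast]
    rw [h4, lt_abs] at hk
    rcases hk with hk | hk <;> linarith [h2.1, h2.2, h3.1, h3.2]
  intro z hz
  refine ⟨i, mk_mem_periodicPts (n := p) (by omega) ?_⟩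
  change S^[p] (S^[i] z) = S^[i] z
  rw [← iterate_add_apply]
  apply Subtype.ext
  have e : p + i = j := by omega
  rw [e, ha _ z hz, ha _ z hz]
  linarith

theorem cutTime_spec {A : Set (Ico (0 : ℝ) 1)} (hcut : ∃ j, ¬ InPiece t (S^[j] '' A)) :
    ¬ InPiece t (S^[cutTime S t A] '' A) :=
  Nat.sInf_mem (s := {j | ¬ InPiece t (S^[j] '' A)}) hcut

theorem inPiece_of_lt_cutTime {A : Set (Ico (0 : ℝ) 1)} {j : ℕ} (hj : j < cutTime S t A) :
    InPiece t (S^[j] '' A) :=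
  not_not.1 (Nat.notMem_of_lt_sInf hj)

theorem HasPieces.exists_translation_of_le_cutTime (h : HasPieces S t c)
    {A : Set (Ico (0 : ℝ) 1)} {j : ℕ} (hj : j ≤ cutTime S t A) :
    ∃ a : ℝ, ∀ x ∈ A, (S^[j] x : ℝ) = x + a :=
  h.exists_translation fun _ hi => inPiece_of_lt_cutTime (hi.trans_le hj)

/-- A set of diameter less than `η` that meets two pieces lies near a division point. -/
theorem HasPieces.exists_mem_sideNhd (h : HasPieces S t c) {A : Set (Ico (0 : ℝ) 1)} {η : ℝ}
    (hdiam : ∀ x ∈ A, ∀ y ∈ A, (y : ℝ) - x < η) (hA : ¬ InPiece t A) {z : Ico (0 : ℝ) 1}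
    (hz : z ∈ A) : ∃ (k : Fin n) (b : Bool), z ∈ sideNhd (t k.castSucc) η b := by
  obtain ⟨k, hk⟩ := h.exists_piece z
  obtain ⟨y, hy, hyk⟩ : ∃ y ∈ A, (y : ℝ) ∉ Ico (t k.castSucc) (t k.succ) := by
    by_contra! hall
    exact hA ⟨k, hall⟩
  have hzy := hdiam z hz y hy
  have hyz := hdiam y hy z hz
  rcases lt_or_ge (y : ℝ) (t k.castSucc) with hlt | hge
  · exact ⟨k, true, hk.1, by linarith⟩
  · obtain ⟨l, hl⟩ := h.exists_piece y
    have hky : t k.succ ≤ y := not_lt.1 fun hlt => hyk ⟨hge, hlt⟩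
    have hkl : k.succ ≤ l.castSucc := by
      have : t k.succ < t l.succ := hky.trans_lt hl.2
      have := h.mono.lt_iff_lt.1 this
      rw [Fin.lt_def] at this
      rw [Fin.le_def]
      simp at this ⊢
      omega
    have := h.mono.monotone hkl
    exact ⟨l, false, by linarith [hl.1], by linarith [hk.2]⟩

/-- At its cut time, every point of a small set `A` is near a division point. -/
theorem HasPieces.iterate_cutTime_mem_sideNhd (h : HasPieces S t c) {A : Set (Ico (0 : ℝ) 1)}
    {η : ℝ} (hdiam : ∀ x ∈ A, ∀ y ∈ A, (y : ℝ) - x < η)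
    (hcut : ∃ j, ¬ InPiece t (S^[j] '' A)) {z : Ico (0 : ℝ) 1} (hz : z ∈ A) :
    ∃ (k : Fin n) (b : Bool), S^[cutTime S t A] z ∈ sideNhd (t k.castSucc) η b := by
  obtain ⟨a, ha⟩ := h.exists_translation_of_le_cutTime (A := A) le_rfl
  refine h.exists_mem_sideNhd ?_ (cutTime_spec hcut) (mem_image_of_mem _ hz)
  rintro _ ⟨x, hx, rfl⟩ _ ⟨y, hy, rfl⟩
  rw [ha x hx, ha y hy]
  linarith [hdiam x hx y hy]

theorem sub_lt_of_mem_sideNhd {d η : ℝ} {b : Bool} {x y : Ico (0 : ℝ) 1}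
    (hx : x ∈ sideNhd d η b) (hy : y ∈ sideNhd d η b) : (y : ℝ) - x < η := by
  cases b <;> simp only [sideNhd, mem_ofPred_eq] at hx hy <;> linarith [hx.1, hx.2, hy.1, hy.2]

/-- A point of a one-sided neighbourhood witnesses that the latter is a non-degenerate interval. -/
theorem exists_interval_subset_sideNhd {d η : ℝ} (hη : 0 < η) {b : Bool} {x : Ico (0 : ℝ) 1}
    (hx : x ∈ sideNhd d η b) (hd : 0 ≤ d) (hd1 : d ≤ 1) :
    ∃ u v : ℝ, u < v ∧ 0 ≤ u ∧ v ≤ 1 ∧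
      ∀ y : Ico (0 : ℝ) 1, u ≤ y → (y : ℝ) < v → y ∈ sideNhd d η b := by
  have h0 := x.2.1
  have h1 := x.2.2
  cases b <;> simp only [sideNhd, mem_ofPred_eq] at hx ⊢
  · exact ⟨max 0 (d - η), d, max_lt (h0.trans_lt hx.2) (by linarith), le_max_left _ _, hd1,
      fun y hy hy' => ⟨(le_max_right _ _).trans hy, hy'⟩⟩
  · exact ⟨d, min 1 (d + η), lt_min (hx.1.trans_lt h1) (by linarith), hd, min_le_left _ _,
      fun y hy hy' => ⟨hy, hy'.trans_le (min_le_right _ _)⟩⟩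

/-- A one-sided neighbourhood narrower than all pieces lies in a single piece. -/
theorem HasPieces.inPiece_sideNhd (h : HasPieces S t c) {η : ℝ}
    (hη : ∀ k : Fin n, η ≤ t k.succ - t k.castSucc) (k : Fin n) (b : Bool) :
    InPiece t (sideNhd (t k.castSucc) η b) := by
  cases b with
  | true => exact ⟨k, fun x hx => ⟨hx.1, by linarith [hx.2, hη k]⟩⟩
  | false =>
    obtain ⟨n, rfl⟩ : ∃ m, n = m + 1 := ⟨n - 1, by have := k.2; omega⟩
    induction k using Fin.cases with
    | zero =>
      refine ⟨0, fun x hx => ?_⟩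
      have := hx.2
      rw [Fin.castSucc_zero, h.zero] at this
      exact absurd x.2.1 (not_le.2 this)
    | succ k =>
      refine ⟨k.castSucc, fun x hx => ⟨?_, ?_⟩⟩
      · have := hη k.castSucc
        have h1 := hx.1
        rw [← Fin.succ_castSucc] at h1
        linarith
      · have h1 := hx.2
        rwa [← Fin.succ_castSucc] at h1

theorem HasPieces.nonneg (h : HasPieces S t c) (i : Fin (n + 1)) : 0 ≤ t i := by
  rw [← h.zero]; exact h.mono.monotone (Fin.zero_le i)

theorem HasPieces.le_one (h : HasPieces S t c) (i : Fin (n + 1)) : t i ≤ 1 := by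
  rw [← h.last]; exact h.mono.monotone (Fin.le_last i)

theorem HasPieces.exists_width_le (h : HasPieces S t c) :
    ∃ η₀ > 0, ∀ k : Fin n, η₀ ≤ t k.succ - t k.castSucc := by
  have hpos : ∀ k : Fin n, 0 < t k.succ - t k.castSucc :=
    fun k => sub_pos.2 (h.mono (Fin.castSucc_lt_succ))
  rcases isEmpty_or_nonempty (Fin n) with he | hne
  · exact ⟨1, one_pos, fun k => he.elim k⟩
  · obtain ⟨k, hk⟩ := Finite.exists_min fun k : Fin n => t k.succ - t k.castSucc
    exact ⟨_, hpos k, hk⟩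

end Pieces

/-! ### Birkhoff sums along aperiodic orbits -/

/-- If every orbit in `G` that starts in one of the finitely many sets `B i` returns to their union
after a block of `τ i` steps, and block sums of `g` have average at most `ω`, then so do all
Birkhoff sums of `g`, up to a constant for the last, incomplete block. -/
theorem abs_birkhoffSum_le_of_blocks {α ι : Type*} [Fintype ι] {S : α → α} {g : α → ℝ}
    {B : ι → Set α} {τ : ι → ℕ} {G : Set α} {M ω : ℝ} (hG : MapsTo S G G)
    (hpos : ∀ i, ∀ x ∈ G, x ∈ B i → 0 < τ i)
    (hnext : ∀ i, ∀ x ∈ G, x ∈ B i → ∃ i', S^[τ i] x ∈ B i')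
    (hM : ∀ x, |g x| ≤ M) (hω : 0 ≤ ω)
    (hblock : ∀ i, ∀ x ∈ G, x ∈ B i → |birkhoffSum S g (τ i) x| ≤ τ i * ω) (N : ℕ) :
    ∀ x ∈ G, ∀ i, x ∈ B i → |birkhoffSum S g N x| ≤ N * ω + (∑ i, (τ i : ℝ)) * M := by
  induction N using Nat.strong_induction_on with
  | _ N ih =>
    intro x hxG i hx
    have hM0 : 0 ≤ M := (abs_nonneg _).trans (hM x)
    rcases lt_or_ge N (τ i) with hlt | hle
    · have h1 : |birkhoffSum S g N x| ≤ N * M := by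
        refine (Finset.abs_sum_le_sum_abs _ _).trans ?_
        simpa using Finset.sum_le_sum fun k (_ : k ∈ Finset.range N) => hM (S^[k] x)
      have h2 : (N : ℝ) ≤ ∑ i, (τ i : ℝ) :=
        (Nat.cast_le.2 hlt.le).trans
          (Finset.single_le_sum (f := fun i => (τ i : ℝ)) (fun _ _ => Nat.cast_nonneg _)
            (Finset.mem_univ i))
      have h3 := mul_le_mul_of_nonneg_right h2 hM0
      have h4 : 0 ≤ N * ω := by positivity
      linarith
    · obtain ⟨i', hi'⟩ := hnext i x hxG hx
      have h1 := ih (N - τ i) (by have := hpos i x hxG hx; omega) _ (hG.iterate (τ i) hxG) i' hi'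
      have h2 := hblock i x hxG hx
      have h3 := birkhoffSum_add S g (τ i) (N - τ i) x
      rw [Nat.add_sub_cancel' hle] at h3
      rw [h3]
      rw [Nat.cast_sub hle] at h1
      linarith [abs_add_le (birkhoffSum S g (τ i) x) (birkhoffSum S g (N - τ i) (S^[τ i] x))]

/-- The points whose orbit is not eventually periodic. -/
def aperiodicPts {α : Type*} (S : α → α) : Set α := {x | ∀ m, S^[m] x ∉ periodicPts S}

theorem mapsTo_aperiodicPts {α : Type*} (S : α → α) :
    MapsTo S (aperiodicPts S) (aperiodicPts S) := fun x hx m => by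
  rw [← iterate_succ_apply]; exact hx (m + 1)

section Pieces

variable {S : Ico (0 : ℝ) 1 → Ico (0 : ℝ) 1} {n : ℕ} {t : Fin (n + 1) → ℝ} {c : Fin n → ℝ}

theorem HasPieces.exists_cut (h : HasPieces S t c) {d η : ℝ} (hη : 0 < η) {b : Bool}
    (hd : 0 ≤ d) (hd1 : d ≤ 1) {x : Ico (0 : ℝ) 1} (hx : x ∈ sideNhd d η b)
    (hxa : x ∈ aperiodicPts S) : ∃ j, ¬ InPiece t (S^[j] '' sideNhd d η b) := by
  by_contra! hcut
  obtain ⟨u, v, huv, hu, hv, hsub⟩ := exists_interval_subset_sideNhd hη hx hd hd1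
  obtain ⟨m, hm⟩ := h.exists_iterate_mem_periodicPts huv hu hv hsub hcut x hx
  exact hxa m hm

/-- If the sums of `g` over the orbit segments of representatives `z` of the one-sided
neighbourhoods of the division points, up to their cut times, vanish, then the Birkhoff averages of
`g` along aperiodic orbits are asymptotically bounded by the oscillation `ω` of `g` at scale `η`,
as such an orbit is a concatenation of segments that shadow those of the representatives. -/
theorem HasPieces.exists_abs_birkhoffSum_le (h : HasPieces S t c) {η : ℝ} (hη : 0 < η)
    (hηw : ∀ k : Fin n, η ≤ t k.succ - t k.castSucc) {g : Ico (0 : ℝ) 1 → ℝ} {M ω : ℝ}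
    (hM : ∀ x, |g x| ≤ M) (hω : 0 ≤ ω)
    (hg : ∀ x y : Ico (0 : ℝ) 1, |(x : ℝ) - y| < η → |g x - g y| ≤ ω)
    {z : Fin n × Bool → Ico (0 : ℝ) 1}
    (hz : ∀ s, (sideNhd (t s.1.castSucc) η s.2).Nonempty → z s ∈ sideNhd (t s.1.castSucc) η s.2)
    (hsum : ∀ s, birkhoffSum S g (cutTime S t (sideNhd (t s.1.castSucc) η s.2)) (z s) = 0) :
    ∃ C : ℝ, ∀ (N : ℕ), ∀ x ∈ aperiodicPts S, |birkhoffSum S g N x| ≤ N * ω + C := by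
  set B : Fin n × Bool → Set (Ico (0 : ℝ) 1) := fun s => sideNhd (t s.1.castSucc) η s.2 with hB
  set τ : Fin n × Bool → ℕ := fun s => cutTime S t (B s) with hτ
  have hcut : ∀ s, ∀ x ∈ aperiodicPts S, x ∈ B s → ∃ j, ¬ InPiece t (S^[j] '' B s) :=
    fun s x hx hxs => h.exists_cut hη (h.nonneg _) (h.le_one _) hxs hx
  have hpos : ∀ s, ∀ x ∈ aperiodicPts S, x ∈ B s → 0 < τ s := by
    intro s x hx hxs
    rw [Nat.pos_iff_ne_zero]
    intro h0
    have := cutTime_spec (hcut s x hx hxs)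
    rw [show cutTime S t (B s) = 0 from h0, iterate_zero, image_id] at this
    exact this (h.inPiece_sideNhd hηw s.1 s.2)
  have hnext : ∀ s, ∀ x ∈ aperiodicPts S, x ∈ B s → ∃ s', S^[τ s] x ∈ B s' := by
    intro s x hx hxs
    obtain ⟨k, b, hkb⟩ := h.iterate_cutTime_mem_sideNhd
      (fun _ hy _ hy' => sub_lt_of_mem_sideNhd hy hy') (hcut s x hx hxs) hxs
    exact ⟨(k, b), hkb⟩
  have hblock : ∀ s, ∀ x ∈ aperiodicPts S, x ∈ B s → |birkhoffSum S g (τ s) x| ≤ τ s * ω := by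
    intro s x _ hxs
    have hzs := hz s ⟨x, hxs⟩
    have h1 : birkhoffSum S g (τ s) x =
        ∑ j ∈ Finset.range (τ s), (g (S^[j] x) - g (S^[j] (z s))) := by
      rw [Finset.sum_sub_distrib]
      have := hsum s
      rw [birkhoffSum] at this
      rw [this, sub_zero, birkhoffSum]
    rw [h1]
    refine (Finset.abs_sum_le_sum_abs _ _).trans ?_
    calc _ ≤ ∑ j ∈ Finset.range (τ s), ω := by
          refine Finset.sum_le_sum fun j hj => hg _ _ ?_
          obtain ⟨a, ha⟩ := h.exists_translation_of_le_cutTime (Finset.mem_range.1 hj).le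
          rw [ha x hxs, ha _ hzs, add_sub_add_right_eq_sub, abs_sub_lt_iff]
          exact ⟨sub_lt_of_mem_sideNhd hzs hxs, sub_lt_of_mem_sideNhd hxs hzs⟩
      _ = _ := by simp
  have hmain := abs_birkhoffSum_le_of_blocks (mapsTo_aperiodicPts S) hpos hnext hM hω hblock
  -- an arbitrary point reaches the one-sided neighbourhoods within a bounded time, as `[0,1)` is
  -- covered by finitely many short intervals
  obtain ⟨L, hL⟩ := exists_nat_gt (1 / η)
  have hL0 : (0 : ℝ) < L := (by positivity : 0 < 1 / η).trans hL
  have hLη : 1 / (L : ℝ) < η := by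
    rw [div_lt_iff₀ hη] at hL
    rw [div_lt_iff₀ hL0]
    linarith
  set A : Fin L → Set (Ico (0 : ℝ) 1) := fun l => sideNhd ((l : ℕ) / L) (1 / L) true with hA
  set T : ℝ := ∑ l, (cutTime S t (A l) : ℝ) with hT
  refine ⟨T * M + (∑ s, (τ s : ℝ)) * M, fun N x hx => ?_⟩
  have hM0 : 0 ≤ M := (abs_nonneg _).trans (hM x)
  obtain ⟨l, hl⟩ : ∃ l, x ∈ A l := by
    have hx0 := x.2.1
    have hx1 := x.2.2
    have hfl := Nat.floor_le (mul_nonneg hL0.le hx0)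
    have hfl' := Nat.lt_floor_add_one ((L : ℝ) * x)
    refine ⟨⟨⌊(L : ℝ) * x⌋₊, ?_⟩, ?_, ?_⟩
    · rw [Nat.floor_lt (mul_nonneg hL0.le hx0)]
      nlinarith
    · rw [div_le_iff₀ hL0]; linarith
    · change (x : ℝ) < (⌊(L : ℝ) * x⌋₊ : ℝ) / L + 1 / L
      rw [← add_div, lt_div_iff₀ hL0]; linarith
  have hlcut : ∃ j, ¬ InPiece t (S^[j] '' A l) :=
    h.exists_cut (by positivity) (by positivity)
      ((div_le_one hL0).2 (Nat.cast_le.2 l.2.le)) hl hx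
  obtain ⟨k, b, hkb⟩ := h.iterate_cutTime_mem_sideNhd
    (fun _ hy _ hy' => (sub_lt_of_mem_sideNhd hy hy').trans hLη) hlcut hl
  have hbd : ∀ m ≤ cutTime S t (A l), |birkhoffSum S g m x| ≤ T * M := by
    intro m hm
    have h1 : |birkhoffSum S g m x| ≤ m * M := by
      refine (Finset.abs_sum_le_sum_abs _ _).trans ?_
      simpa using Finset.sum_le_sum fun k (_ : k ∈ Finset.range m) => hM (S^[k] x)
    refine h1.trans (mul_le_mul_of_nonneg_right ?_ hM0)
    exact (Nat.cast_le.2 hm).trans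
      (Finset.single_le_sum (f := fun l => (cutTime S t (A l) : ℝ)) (fun _ _ => Nat.cast_nonneg _)
        (Finset.mem_univ l))
  have hC : 0 ≤ (∑ s, (τ s : ℝ)) * M := by positivity
  have hNω : 0 ≤ N * ω := by positivity
  rcases le_total N (cutTime S t (A l)) with hle | hle
  · linarith [hbd N hle]
  · have h1 := hmain (N - cutTime S t (A l)) _
      ((mapsTo_aperiodicPts S).iterate (cutTime S t (A l)) hx) (k, b) hkb
    have h2 := hbd _ le_rfl
    have h3 := birkhoffSum_add S g (cutTime S t (A l)) (N - cutTime S t (A l)) x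
    rw [Nat.add_sub_cancel' hle] at h3
    rw [h3]
    rw [Nat.cast_sub hle] at h1
    have h4 : 0 ≤ (cutTime S t (A l) : ℝ) * ω := by positivity
    linarith [abs_add_le (birkhoffSum S g (cutTime S t (A l)) x)
      (birkhoffSum S g (N - cutTime S t (A l)) (S^[cutTime S t (A l)] x))]

end Pieces

/-! ### Integrals of Birkhoff sums -/

section Invariant

variable {α : Type*} [MeasurableSpace α] {S : α → α} {μ : Measure α}

theorem ae_mem_aperiodicPts (hS : MeasurePreserving S μ μ) (hper : μ (periodicPts S) = 0) :
    ∀ᵐ x ∂μ, x ∈ aperiodicPts S := by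
  have : ∀ m, ∀ᵐ x ∂μ, S^[m] x ∉ periodicPts S := fun m =>
    (hS.iterate m).quasiMeasurePreserving.ae (measure_eq_zero_iff_ae_notMem.1 hper)
  exact ae_all_iff.2 this

theorem integral_birkhoffSum (hS : MeasurePreserving S μ μ) {g : α → ℝ} (hg : Integrable g μ)
    (N : ℕ) : ∫ x, birkhoffSum S g N x ∂μ = N * ∫ x, g x ∂μ := by
  have hi : ∀ k, Integrable (fun x => g (S^[k] x)) μ := fun k =>
    (hS.iterate k).integrable_comp_of_integrable hg
  simp only [birkhoffSum]
  rw [integral_finsetSum _ fun k _ => hi k]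
  have : ∀ k, ∫ x, g (S^[k] x) ∂μ = ∫ x, g x ∂μ := fun k => by
    have hk := hS.iterate k
    conv_rhs => rw [← hk.map_eq]
    rw [integral_map hk.measurable.aemeasurable]
    rw [hk.map_eq]
    exact hg.aestronglyMeasurable
  simp [this]

theorem abs_integral_le_of_birkhoffSum_le [IsProbabilityMeasure μ] (hS : MeasurePreserving S μ μ)
    {g : α → ℝ} (hg : Integrable g μ) {ω C : ℝ}
    (hb : ∀ N : ℕ, ∀ᵐ x ∂μ, |birkhoffSum S g N x| ≤ N * ω + C) : |∫ x, g x ∂μ| ≤ ω := by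
  have key : ∀ N : ℕ, N * |∫ x, g x ∂μ| ≤ N * ω + C := by
    intro N
    have := norm_integral_le_of_norm_le_const (μ := μ) (f := fun x => birkhoffSum S g N x)
      (C := N * ω + C) (hb N)
    rw [integral_birkhoffSum hS hg, Real.norm_eq_abs, abs_mul, Nat.abs_cast] at this
    simpa using this
  by_contra! hlt
  obtain ⟨N, hN⟩ := exists_nat_gt (C / (|∫ x, g x ∂μ| - ω))
  rw [div_lt_iff₀ (by linarith)] at hN
  linarith [key N]

end Invariant

/-! ### Counting measures without periodic mass -/

/-- Uniformly continuous bounded functions that almost separate probability measures carried by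
sets that are null for each other. -/
theorem exists_separating_functions {r : ℕ} (μ : Fin r → Measure (Ico (0 : ℝ) 1))
    [∀ i, IsProbabilityMeasure (μ i)] {A : Fin r → Set (Ico (0 : ℝ) 1)}
    (hA : ∀ k, MeasurableSet (A k)) (hfull : ∀ k, μ k (A k)ᶜ = 0)
    (hnull : ∀ i k, i ≠ k → μ i (A k) = 0) {ε : ℝ} (hε : 0 < ε) :
    ∃ f : Fin r → Ico (0 : ℝ) 1 → ℝ, ∀ k, UniformContinuous (f k) ∧ (∃ M, ∀ x, |f k x| ≤ M) ∧
      ∀ i, |∫ x, f k x ∂μ i - if i = k then 1 else 0| ≤ ε := by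
  have : LocallyCompactSpace (Ico (0 : ℝ) 1) :=
    Topology.IsInducing.subtypeVal.locallyCompactSpace (by
      rw [Subtype.range_coe]; exact isLocallyClosed_Ico)
  have hfun : ∀ k, ∃ f : Ico (0 : ℝ) 1 → ℝ, UniformContinuous f ∧ (∃ M, ∀ x, |f x| ≤ M) ∧
      ∀ i, |∫ x, f x ∂μ i - if i = k then 1 else 0| ≤ ε := by
    intro k
    set ν : Measure (Ico (0 : ℝ) 1) := Measure.sum μ with hν
    have hind : Integrable ((A k).indicator fun _ => (1 : ℝ)) ν :=
      (integrable_const 1).indicator (hA k)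
    obtain ⟨f, hfc, hfi, hf, hfint⟩ := hind.exists_hasCompactSupport_integral_sub_le hε
    refine ⟨f, hfc.uniformContinuous_of_continuous hf, hfc.exists_bound_of_continuous hf,
      fun i => ?_⟩
    have hle : μ i ≤ ν := Measure.le_sum μ i
    have hval : ∫ x, (A k).indicator (fun _ => (1 : ℝ)) x ∂μ i = if i = k then 1 else 0 := by
      rw [integral_indicator (hA k), setIntegral_const, smul_eq_mul, mul_one]
      split_ifs with hik
      · subst hik
        rw [measureReal_def, (prob_compl_eq_zero_iff (hA i)).1 (hfull i)]; simp
      · rw [measureReal_def, hnull i k hik]; simp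
    rw [← hval, abs_sub_comm, ← integral_sub (hind.mono_measure hle) (hfint.mono_measure hle)]
    refine abs_integral_le_integral_abs.trans (le_trans ?_ hfi)
    exact integral_mono_measure hle (Filter.Eventually.of_forall fun _ => abs_nonneg _)
      (hind.sub hfint).abs
  choose f hf using hfun
  exact ⟨f, hf⟩

/-- Invariant probability measures that do not charge the periodic points and are carried by sets
null for each other are at most as many as the one-sided division points. Their integrals are
limits of combinations of block averages over as many blocks, so with more measures there would be
a nontrivial combination `∑ k, v k • f k` of functions separating them with vanishing block sums. -/
theorem HasPieces.card_le {S : Ico (0 : ℝ) 1 → Ico (0 : ℝ) 1} {n : ℕ} {t : Fin (n + 1) → ℝ}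
    {c : Fin n → ℝ} (h : HasPieces S t c) {r : ℕ} (μ : Fin r → Measure (Ico (0 : ℝ) 1))
    (hprob : ∀ i, IsProbabilityMeasure (μ i)) (hinv : ∀ i, MeasurePreserving S (μ i) (μ i))
    (hper : ∀ i, μ i (periodicPts S) = 0) {A : Fin r → Set (Ico (0 : ℝ) 1)}
    (hA : ∀ k, MeasurableSet (A k)) (hfull : ∀ k, μ k (A k)ᶜ = 0)
    (hnull : ∀ i k, i ≠ k → μ i (A k) = 0) : r ≤ 2 * n := by
  by_contra! hr
  have hr0 : (0 : ℝ) < r := by exact_mod_cast (Nat.zero_le _).trans_lt hr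
  set ε : ℝ := 1 / (4 * r) with hε
  have hε0 : 0 < ε := by positivity
  have hrε : r * ε = 1 / 4 := by rw [hε]; field_simp
  obtain ⟨f, hf⟩ := exists_separating_functions μ hA hfull hnull hε0
  choose hfu hfb hfint using hf
  choose M hM using hfb
  -- a common scale at which all the test functions oscillate little
  obtain ⟨η, hη, hηw, hηf⟩ : ∃ η > 0, (∀ k : Fin n, η ≤ t k.succ - t k.castSucc) ∧
      ∀ k, ∀ x y : Ico (0 : ℝ) 1, |(x : ℝ) - y| < η → |f k x - f k y| ≤ ε := by
    obtain ⟨η₀, hη₀, hw⟩ := h.exists_width_le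
    choose δ hδ hδf using fun k => Metric.uniformContinuous_iff.1 (hfu k) ε hε0
    have : Nonempty (Fin r) := ⟨⟨0, by omega⟩⟩
    obtain ⟨k₀, hk₀⟩ := Finite.exists_min δ
    refine ⟨min η₀ (δ k₀), lt_min hη₀ (hδ _), fun k => (min_le_left _ _).trans (hw k),
      fun k x y hxy => ?_⟩
    have := hδf k (a := x) (b := y) (by
      rw [Subtype.dist_eq, Real.dist_eq]
      exact hxy.trans_le ((min_le_right _ _).trans (hk₀ k)))
    exact (Real.dist_eq _ _ ▸ this).le
  -- representatives of the one-sided neighbourhoods; the value for an empty one is irrelevant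
  obtain ⟨z, hz⟩ : ∃ z : Fin n × Bool → Ico (0 : ℝ) 1, ∀ s,
      (sideNhd (t s.1.castSucc) η s.2).Nonempty → z s ∈ sideNhd (t s.1.castSucc) η s.2 := by
    have : ∀ s : Fin n × Bool, ∃ x : Ico (0 : ℝ) 1,
        (sideNhd (t s.1.castSucc) η s.2).Nonempty → x ∈ sideNhd (t s.1.castSucc) η s.2 := by
      intro s
      by_cases hs : (sideNhd (t s.1.castSucc) η s.2).Nonempty
      · exact ⟨hs.some, fun _ => hs.some_mem⟩
      · exact ⟨⟨0, by simp⟩, fun hs' => absurd hs' hs⟩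
    choose z hz using this
    exact ⟨z, hz⟩
  obtain ⟨v, hv0, hv⟩ : ∃ v : Fin r → ℝ, v ≠ 0 ∧ ∀ s : Fin n × Bool, ∑ k,
      birkhoffSum S (f k) (cutTime S t (sideNhd (t s.1.castSucc) η s.2)) (z s) * v k = 0 := by
    set Λ := Matrix.mulVecLin (Matrix.of fun (s : Fin n × Bool) (k : Fin r) =>
      birkhoffSum S (f k) (cutTime S t (sideNhd (t s.1.castSucc) η s.2)) (z s)) with hΛ
    have hker : LinearMap.ker Λ ≠ ⊥ := by
      apply LinearMap.ker_ne_bot_of_finrank_lt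
      simp only [Module.finrank_fintype_fun_eq_card, Fintype.card_prod, Fintype.card_fin,
        Fintype.card_bool]
      omega
    obtain ⟨v, hv, hv0⟩ := (Submodule.ne_bot_iff _).1 hker
    refine ⟨v, hv0, fun s => ?_⟩
    exact congrFun (LinearMap.mem_ker.1 hv) s
  have : Nonempty (Fin r) := ⟨⟨0, by omega⟩⟩
  obtain ⟨i, hi⟩ := Finite.exists_max fun k => |v k|
  have hvi : 0 < |v i| := by
    rw [abs_pos]
    intro h0
    apply hv0
    ext k
    have := hi k
    rw [h0, abs_zero] at this
    exact abs_nonpos_iff.1 this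
  set g : Ico (0 : ℝ) 1 → ℝ := fun x => ∑ k, v k * f k x with hg
  have hgsum : ∀ (N : ℕ) (x : Ico (0 : ℝ) 1),
      birkhoffSum S g N x = ∑ k, birkhoffSum S (f k) N x * v k := by
    intro N x
    simp only [birkhoffSum, hg, Finset.sum_mul]
    rw [Finset.sum_comm]
    exact Finset.sum_congr rfl fun _ _ => Finset.sum_congr rfl fun _ _ => mul_comm _ _
  have hfi : ∀ k, Integrable (f k) (μ i) := fun k =>
    Integrable.of_bound (hfu k).continuous.aestronglyMeasurable (M k)
      (Filter.Eventually.of_forall (hM k))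
  have hgint : Integrable g (μ i) := integrable_finsetSum _ fun k _ => (hfi k).const_mul _
  obtain ⟨C, hC⟩ := h.exists_abs_birkhoffSum_le hη hηw (g := g) (M := ∑ k, |v k| * M k)
    (ω := ∑ k, |v k| * ε)
    (fun x => (Finset.abs_sum_le_sum_abs _ _).trans (Finset.sum_le_sum fun k _ => by
      rw [abs_mul]; exact mul_le_mul_of_nonneg_left (hM k x) (abs_nonneg _)))
    (by positivity)
    (fun x y hxy => by
      rw [hg]
      simp only
      rw [← Finset.sum_sub_distrib]
      refine (Finset.abs_sum_le_sum_abs _ _).trans (Finset.sum_le_sum fun k _ => ?_)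
      rw [← mul_sub, abs_mul]
      exact mul_le_mul_of_nonneg_left (hηf k x y hxy) (abs_nonneg _))
    hz (fun s => by rw [hgsum]; exact hv s)
  have hsmall : |∫ x, g x ∂μ i| ≤ |v i| * (1 / 4) := by
    have hae := ae_mem_aperiodicPts (hinv i) (hper i)
    refine (abs_integral_le_of_birkhoffSum_le (hinv i) hgint
      fun N => hae.mono fun x hx => hC N x hx).trans ?_
    calc ∑ k, |v k| * ε ≤ ∑ _k : Fin r, |v i| * ε :=
          Finset.sum_le_sum fun k _ => mul_le_mul_of_nonneg_right (hi k) hε0.le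
      _ = |v i| * (r * ε) := by simp; ring
      _ = _ := by rw [hrε]
  have hlarge : |∫ x, g x ∂μ i - v i| ≤ |v i| * (1 / 4) := by
    have h1 : ∫ x, g x ∂μ i = ∑ k, v k * ∫ x, f k x ∂μ i := by
      rw [hg, integral_finsetSum _ fun k _ => (hfi k).const_mul _]
      simp only [integral_const_mul]
    have h2 : v i = ∑ k, v k * (if i = k then 1 else 0) := by simp
    calc |∫ x, g x ∂μ i - v i|
        = |∑ k, v k * (∫ x, f k x ∂μ i - if i = k then 1 else 0)| := by
          conv_lhs => rw [h2]
          rw [h1, ← Finset.sum_sub_distrib]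
          simp only [mul_sub]
      _ ≤ ∑ _k : Fin r, |v i| * ε := by
          refine (Finset.abs_sum_le_sum_abs _ _).trans (Finset.sum_le_sum fun k _ => ?_)
          rw [abs_mul]
          exact mul_le_mul (hi k) (hfint k i) (abs_nonneg _) (abs_nonneg _)
      _ = |v i| * (r * ε) := by simp; ring
      _ = _ := by rw [hrε]
  have := abs_sub_abs_le_abs_sub (v i) (∫ x, g x ∂μ i)
  rw [abs_sub_comm] at this
  linarith

/-! ### Non-atomic ergodic measures -/

/-- Distinct ergodic measures are mutually singular: the absolutely continuous part of `ν` with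
respect to `μ` is invariant, hence a multiple of `ν`. -/
theorem Ergodic.mutuallySingular_of_ne {α : Type*} [MeasurableSpace α] {f : α → α}
    {μ ν : Measure α} [IsProbabilityMeasure μ] [IsProbabilityMeasure ν] (hμ : Ergodic f μ)
    (hν : Ergodic f ν) (hne : ν ≠ μ) : ν ⟂ₘ μ := by
  have hinv := hν.toMeasurePreserving.withDensity_rnDeriv hμ.toMeasurePreserving
  have hac : μ.withDensity (ν.rnDeriv μ) ≪ ν :=
    (Measure.withDensity_rnDeriv_le ν μ).absolutelyContinuous
  have : IsFiniteMeasure (μ.withDensity (ν.rnDeriv μ)) :=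
    isFiniteMeasure_of_le _ (Measure.withDensity_rnDeriv_le ν μ)
  obtain ⟨a, ha⟩ := hν.eq_smul_of_absolutelyContinuous hinv hac
  rcases eq_or_ne a 0 with rfl | ha0
  · rw [zero_smul] at ha
    exact (Measure.withDensity_rnDeriv_eq_zero _ _).1 ha
  · refine absurd (hμ.eq_of_absolutelyContinuous hν.toMeasurePreserving ?_) hne
    have h1 : ν ≪ a • ν := Measure.absolutelyContinuous_smul ha0
    rw [← ha] at h1
    exact h1.trans (withDensity_absolutelyContinuous _ _)

section

variable {S : Ico (0 : ℝ) 1 → Ico (0 : ℝ) 1}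

theorem exists_limsup_orbit_eq {x : Ico (0 : ℝ) 1} (hx : x ∈ periodicPts S) :
    ∃ y : Ico (0 : ℝ) 1, Filter.limsup (fun m => (S^[m] x : ℝ)) Filter.atTop = y ∧
      ∃ m, S^[m] y = x := by
  obtain ⟨p, hp, hxp⟩ := mem_periodicPts.1 hx
  obtain ⟨j, hj, hmax⟩ := (Finset.range p).exists_max_image (fun m => (S^[m] x : ℝ))
    ⟨0, Finset.mem_range.2 hp⟩
  have hle : ∀ m, (S^[m] x : ℝ) ≤ S^[j] x := fun m => by
    rw [← hxp.iterate_mod_apply m]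
    exact hmax _ (Finset.mem_range.2 (Nat.mod_lt _ hp))
  have hper : ∀ a, S^[j + a * p] x = S^[j] x := fun a => by
    rw [iterate_add_apply, (hxp.const_mul a).eq]
  refine ⟨S^[j] x, le_antisymm ?_ ?_, p - j, ?_⟩
  · exact Filter.limsup_le_of_le (Filter.isCoboundedUnder_le_of_le _ fun m => (S^[m] x).2.1)
      (Filter.Eventually.of_forall hle)
  · refine Filter.le_limsup_of_frequently_le ?_
      (Filter.isBoundedUnder_of ⟨1, fun m => (S^[m] x).2.2.le⟩)
    refine Filter.frequently_atTop.2 fun a => ⟨j + a * p, ?_, (congrArg Subtype.val (hper a)).ge⟩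
    nlinarith
  · rw [← iterate_add_apply, Nat.sub_add_cancel (Finset.mem_range.1 hj).le]
    exact hxp

/-- A non-atomic ergodic measure does not charge the periodic points: the upper limit along the
orbit is an invariant function, hence a.e. constant, so that almost all periodic points lie on the
orbit of a single point. -/
theorem measure_periodicPts_eq_zero {μ : Measure (Ico (0 : ℝ) 1)} (hμ : μ ∈ nonatomicErgodic S) :
    μ (periodicPts S) = 0 := by
  obtain ⟨_, _, herg⟩ := hμ
  set u : Ico (0 : ℝ) 1 → ℝ := fun x => Filter.limsup (fun m => (S^[m] x : ℝ)) Filter.atTop with hu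
  have hum : Measurable u := Measurable.limsup fun m =>
    measurable_subtype_coe.comp (herg.measurable.iterate m)
  have huS : u ∘ S = u := by
    ext x
    exact Filter.limsup_nat_add (fun m => (S^[m] x : ℝ)) 1
  obtain ⟨a, ha⟩ := herg.toPreErgodic.ae_eq_const_of_ae_eq_comp hum huS
  by_cases hex : ∃ y : Ico (0 : ℝ) 1, (y : ℝ) = a
  · obtain ⟨y, rfl⟩ := hex
    have hcount : μ (range fun m => S^[m] y) = 0 := (countable_range _).measure_zero μ
    refine measure_mono_null_ae ?_ hcount
    filter_upwards [ha] with x hx hxp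
    obtain ⟨y', hy', m, hm⟩ := exists_limsup_orbit_eq hxp
    have : y' = y := Subtype.ext (hy'.symm.trans hx)
    exact ⟨m, this ▸ hm⟩
  · rw [measure_eq_zero_iff_ae_notMem]
    filter_upwards [ha] with x hx hxp
    obtain ⟨y, hy, -⟩ := exists_limsup_orbit_eq hxp
    exact hex ⟨y, hy.symm.trans hx⟩

theorem IsITM.finite_nonatomicErgodic (hS : IsITM S) : (nonatomicErgodic S).Finite := by
  obtain ⟨n, t, c, h⟩ := hS.exists_hasPieces
  by_contra hinf
  set φ := Set.Infinite.natEmbedding _ hinf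
  set μ : Fin (2 * n + 1) → Measure (Ico (0 : ℝ) 1) := fun i => φ i with hμ
  have hmem : ∀ i, μ i ∈ nonatomicErgodic S := fun i => (φ i).2
  have : ∀ i, IsProbabilityMeasure (μ i) := fun i => (hmem i).1
  have hsing : ∀ k i, i ≠ k → μ k ⟂ₘ μ i := fun k i hik =>
    (hmem i).2.2.mutuallySingular_of_ne (hmem k).2.2 fun heq =>
      hik (Fin.ext (φ.injective (Subtype.ext heq)).symm)
  have hset : ∀ k i, ∃ s, MeasurableSet s ∧ (i ≠ k → μ k s = 0 ∧ μ i sᶜ = 0) := by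
    intro k i
    by_cases hik : i = k
    · exact ⟨∅, MeasurableSet.empty, fun hne => absurd hik hne⟩
    · obtain ⟨s, hs, h1, h2⟩ := hsing k i hik
      exact ⟨s, hs, fun _ => ⟨h1, h2⟩⟩
  choose s hsm hs using hset
  have := h.card_le μ this (fun i => (hmem i).2.2.toMeasurePreserving)
    (fun i => measure_periodicPts_eq_zero (hmem i)) (A := fun k => ⋂ i, ⋂ _ : i ≠ k, (s k i)ᶜ)
    (fun k => MeasurableSet.iInter fun i => MeasurableSet.iInter fun _ => (hsm k i).compl)
    (fun k => by
      simp only [compl_iInter, compl_compl]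
      exact measure_iUnion_null fun i => measure_iUnion_null fun hik => (hs k i hik).1)
    (fun i k hik => measure_mono_null (iInter₂_subset i hik) (hs k i hik).2)
  omega

/-! ### Ergodic components of measures without periodic mass -/

/-- By Poincaré recurrence, atoms of finite invariant measures are periodic points. -/
theorem nullSingletonClass_of_measure_periodicPts {ν : Measure (Ico (0 : ℝ) 1)}
    [IsFiniteMeasure ν] (hν : MeasurePreserving S ν ν) (hper : ν (periodicPts S) = 0) :
    NullSingletonClass ν := by
  refine ⟨fun x => ?_⟩
  by_contra hx
  obtain ⟨y, rfl, m, hm, hy⟩ :=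
    hν.conservative.exists_mem_iterate_mem (measurableSet_singleton x).nullMeasurableSet hx
  exact hx (measure_mono_null
    (singleton_subset_iff.2 (mk_mem_periodicPts (Nat.pos_of_ne_zero hm) hy)) hper)

theorem measurePreserving_cond {α : Type*} [MeasurableSpace α] {f : α → α} {ν : Measure α}
    (hν : MeasurePreserving f ν ν) {A : Set α} (hA : MeasurableSet A) (hfA : f ⁻¹' A = A) :
    MeasurePreserving f (ProbabilityTheory.cond ν A) (ProbabilityTheory.cond ν A) := by
  refine MeasurePreserving.smul_measure ?_ _
  have := hν.restrict_preimage hA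
  rwa [hfA] at this

theorem cond_eq_zero_of_measure_eq_zero {α : Type*} [MeasurableSpace α] {ν : Measure α}
    {A B : Set α} (hB : ν B = 0) : ProbabilityTheory.cond ν A B = 0 :=
  ProbabilityTheory.cond_absolutelyContinuous hB

/-- An invariant set that no invariant set splits carries an ergodic conditional measure. -/
theorem ergodic_cond {α : Type*} [MeasurableSpace α] {f : α → α} {ν : Measure α}
    (hν : MeasurePreserving f ν ν) {A : Set α} (hA : MeasurableSet A) (hfA : f ⁻¹' A = A)
    (hatom : ∀ B, MeasurableSet B → f ⁻¹' B = B → ν (A ∩ B) = 0 ∨ ν (A \ B) = 0) :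
    Ergodic f (ProbabilityTheory.cond ν A) := by
  refine ⟨measurePreserving_cond hν hA hfA, ⟨fun B hB hfB => ?_⟩⟩
  rw [Filter.eventuallyConst_set]
  rcases hatom B hB hfB with h0 | h0
  · right
    refine measure_eq_zero_iff_ae_notMem.1 ?_
    rw [ProbabilityTheory.cond_apply hA, h0, mul_zero]
  · left
    change _ ∈ ae _
    rw [mem_ae_iff, ProbabilityTheory.cond_apply hA]
    change _ * ν (A \ B) = 0
    rw [h0, mul_zero]

/-- Every set that an invariant measure without periodic mass charges is charged by an ergodic
conditional measure: otherwise one could split off invariant sets of positive measure forever. -/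
theorem IsITM.exists_ergodic_cond (hS : IsITM S) {ν : Measure (Ico (0 : ℝ) 1)}
    [IsFiniteMeasure ν] (hν : MeasurePreserving S ν ν) (hper : ν (periodicPts S) = 0)
    {U : Set (Ico (0 : ℝ) 1)} (hU : ν U ≠ 0) :
    ∃ A, MeasurableSet A ∧ ν (A ∩ U) ≠ 0 ∧ Ergodic S (ProbabilityTheory.cond ν A) := by
  obtain ⟨n, t, c, h⟩ := hS.exists_hasPieces
  by_contra! hno
  have hsplit : ∀ A, MeasurableSet A ∧ S ⁻¹' A = A ∧ ν (A ∩ U) ≠ 0 →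
      ∃ A', (MeasurableSet A' ∧ S ⁻¹' A' = A' ∧ ν (A' ∩ U) ≠ 0) ∧ A' ⊆ A ∧ ν (A \ A') ≠ 0 := by
    rintro A ⟨hA, hSA, hAU⟩
    obtain ⟨B, hB, hSB, h1, h2⟩ : ∃ B, MeasurableSet B ∧ S ⁻¹' B = B ∧ ν (A ∩ B) ≠ 0 ∧
        ν (A \ B) ≠ 0 := by
      by_contra! hatom
      refine hno A hA hAU (ergodic_cond hν hA hSA fun B hB hSB => ?_)
      rw [or_iff_not_imp_left]
      exact hatom B hB hSB
    by_cases hBU : ν (A ∩ B ∩ U) = 0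
    · refine ⟨A \ B, ⟨hA.diff hB, by rw [preimage_sdiff, hSA, hSB], fun h0 => hAU ?_⟩,
        sdiff_subset, by rwa [sdiff_sdiff_right_self]⟩
      refine measure_mono_null ?_ (measure_union_null hBU h0)
      rw [← union_inter_distrib_right, inter_union_sdiff]
    · exact ⟨A ∩ B, ⟨hA.inter hB, by rw [preimage_inter, hSA, hSB], hBU⟩, inter_subset_left,
        by rwa [sdiff_self_inter]⟩
  choose! F hF hFsub hFpos using hsplit
  set A : ℕ → Set (Ico (0 : ℝ) 1) := fun k => F^[k] univ with hAdef
  have hsucc : ∀ k, A (k + 1) = F (A k) := fun k => iterate_succ_apply' F k univ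
  have hA : ∀ k, MeasurableSet (A k) ∧ S ⁻¹' A k = A k ∧ ν (A k ∩ U) ≠ 0 := by
    intro k
    induction k with
    | zero => exact ⟨MeasurableSet.univ, preimage_univ, by simpa [hAdef] using hU⟩
    | succ k ih => rw [hsucc]; exact hF _ ih
  have hanti : Antitone A := antitone_nat_of_succ_le fun k => by
    rw [hsucc]; exact hFsub _ (hA k)
  set D : ℕ → Set (Ico (0 : ℝ) 1) := fun k => A k \ A (k + 1) with hD
  have hDpos : ∀ k, ν (D k) ≠ 0 := fun k => by
    have := hFpos _ (hA k)
    rwa [← hsucc] at this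
  have hDm : ∀ k, MeasurableSet (D k) := fun k => (hA k).1.diff (hA (k + 1)).1
  have hDS : ∀ k, S ⁻¹' D k = D k := fun k => by
    rw [hD]
    simp only
    rw [preimage_sdiff, (hA k).2.1, (hA (k + 1)).2.1]
  have hdisj : ∀ i k, i < k → D i ∩ D k = ∅ := fun i k hik => by
    ext x
    simp only [mem_inter_iff, mem_empty_iff_false, iff_false, not_and]
    exact fun h1 h2 => h1.2 (hanti (Nat.succ_le_of_lt hik) h2.1)
  have := h.card_le (r := 2 * n + 1) (fun i => ProbabilityTheory.cond ν (D i))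
    (fun i => ProbabilityTheory.cond_isProbabilityMeasure (hDpos i))
    (fun i => measurePreserving_cond hν (hDm i) (hDS i))
    (fun i => cond_eq_zero_of_measure_eq_zero hper) (A := fun k => D k) (fun k => hDm k)
    (fun k => by rw [ProbabilityTheory.cond_apply (hDm k)]; simp)
    (fun i k hik => by
      rw [ProbabilityTheory.cond_apply (hDm i)]
      rcases lt_or_gt_of_ne (Fin.val_ne_of_ne hik) with hlt | hlt
      · rw [hdisj _ _ hlt]; simp
      · rw [inter_comm, hdisj _ _ hlt]; simp)
  omega

theorem IsITM.absolutelyContinuous_maximalNonatomic (hS : IsITM S) {ν : Measure (Ico (0 : ℝ) 1)}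
    [IsFiniteMeasure ν] (hν : MeasurePreserving S ν ν) (hper : ν (periodicPts S) = 0) :
    ν ≪ maximalNonatomic S := by
  refine Measure.AbsolutelyContinuous.mk fun U hU hU0 => ?_
  by_contra hνU
  obtain ⟨A, hA, hAU, herg⟩ := hS.exists_ergodic_cond hν hper hνU
  have hfin := hS.finite_nonatomicErgodic
  have hA0 : ν A ≠ 0 := fun h0 => hAU (measure_mono_null inter_subset_left h0)
  have hprob := ProbabilityTheory.cond_isProbabilityMeasure hA0
  have hmem : ProbabilityTheory.cond ν A ∈ nonatomicErgodic S :=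
    ⟨hprob, nullSingletonClass_of_measure_periodicPts herg.toMeasurePreserving
      (cond_eq_zero_of_measure_eq_zero hper), herg⟩
  rw [maximalNonatomic, Measure.smul_apply, smul_eq_mul, mul_eq_zero, ENNReal.inv_eq_zero,
    finsum_mem_eq_finite_toFinset_sum _ hfin, Measure.finsetSum_apply] at hU0
  have h0 := hU0.resolve_left (ENNReal.natCast_ne_top _)
  rw [Finset.sum_eq_zero_iff] at h0
  have := h0 _ (hfin.mem_toFinset.2 hmem)
  rw [ProbabilityTheory.cond_apply hA, mul_eq_zero, ENNReal.inv_eq_zero] at this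
  exact hAU (this.resolve_left (measure_ne_top _ _))

/-! ### The periodic part -/

/-- Near a periodic point, the points to its right are periodic and move along with it. -/
theorem IsITM.exists_rigid_Ico (hS : IsITM S) {x : Ico (0 : ℝ) 1} (hx : x ∈ periodicPts S) :
    ∃ b : ℝ, (x : ℝ) < b ∧ b ≤ 1 ∧ {y : Ico (0 : ℝ) 1 | x ≤ y ∧ (y : ℝ) < b} ⊆ rigidUnion S := by
  obtain ⟨n, t, c, h⟩ := hS.exists_hasPieces
  -- each iterate is a translation on some interval to the right of `x`
  have htr : ∀ m, ∃ b : ℝ, (x : ℝ) < b ∧ b ≤ 1 ∧ ∀ j ≤ m, ∃ a : ℝ,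
      ∀ y : Ico (0 : ℝ) 1, x ≤ y → (y : ℝ) < b → (S^[j] y : ℝ) = y + a := by
    intro m
    induction m with
    | zero =>
      refine ⟨1, x.2.2, le_rfl, fun j hj => ⟨0, fun y _ _ => ?_⟩⟩
      obtain rfl : j = 0 := by omega
      simp
    | succ m ih =>
      obtain ⟨b, hxb, hb1, hb⟩ := ih
      obtain ⟨a, ha⟩ := hb m le_rfl
      obtain ⟨k, hk⟩ := h.exists_piece (S^[m] x)
      have hax := ha x le_rfl hxb
      refine ⟨min b (t k.succ - a), lt_min hxb (by linarith [hk.2]), (min_le_left _ _).trans hb1,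
        fun j hj => ?_⟩
      rcases Nat.of_le_succ hj with hj | rfl
      · obtain ⟨a', ha'⟩ := hb j hj
        exact ⟨a', fun y hxy hyb => ha' y hxy (hyb.trans_le (min_le_left _ _))⟩
      · refine ⟨a + c k, fun y hxy hyb => ?_⟩
        have h1 := ha y hxy (hyb.trans_le (min_le_left _ _))
        have h2 := hyb.trans_le (min_le_right _ _)
        have h3 : (x : ℝ) ≤ y := hxy
        rw [iterate_succ_apply', h.map_eq k _ ⟨by linarith [hk.1], by linarith⟩, h1]
        ring
  obtain ⟨p, hp, hxp⟩ := mem_periodicPts.1 hx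
  obtain ⟨b, hxb, hb1, hb⟩ := htr p
  set J : Set (Ico (0 : ℝ) 1) := {y | x ≤ y ∧ (y : ℝ) < b} with hJ
  have hid : ∀ y ∈ J, IsPeriodicPt S p y := by
    rintro y ⟨hxy, hyb⟩
    obtain ⟨a, ha⟩ := hb p le_rfl
    have h1 := ha x le_rfl hxb
    rw [hxp.eq] at h1
    have h2 := ha y hxy hyb
    apply Subtype.ext
    linarith
  refine ⟨b, hxb, hb1, subset_sUnion_of_mem ⟨⟨⟨?_⟩, ?_, fun m => ?_⟩, fun y hy =>
    mk_mem_periodicPts hp (hid y hy)⟩⟩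
  · exact fun y hy z hz w hw => ⟨hy.1.trans hw.1, lt_of_le_of_lt hw.2 hz.2⟩
  · have h0 := x.2.1
    refine ⟨x, ⟨le_rfl, hxb⟩, ⟨(x + b) / 2, by constructor <;> linarith⟩,
      ⟨?_, ?_⟩, fun heq => ?_⟩
    · change (x : ℝ) ≤ (x + b) / 2; linarith
    · change ((x : ℝ) + b) / 2 < b; linarith
    · have : (x : ℝ) = (x + b) / 2 := congrArg Subtype.val heq
      linarith
  · obtain ⟨a, ha⟩ := hb (m % p) (Nat.mod_lt _ hp).le
    rw [continuousOn_iff_continuous_domRestrict, continuous_induced_rng]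
    have : (Subtype.val ∘ J.domRestrict S^[m]) = fun y : J => ((y : Ico (0 : ℝ) 1) : ℝ) + a := by
      ext y
      change (S^[m] (y : Ico (0 : ℝ) 1) : ℝ) = _
      rw [← (hid y y.2).iterate_mod_apply m]
      exact ha y y.2.1 y.2.2
    change Continuous (Subtype.val ∘ J.domRestrict S^[m])
    rw [this]
    fun_prop

theorem lebesgueIco_univ : lebesgueIco univ = 1 := by
  rw [lebesgueIco, (MeasurableEmbedding.subtype_coe measurableSet_Ico).comap_apply, image_univ,
    Subtype.range_coe, Real.volume_Ico]
  simp

/-- The periodic measure charges every neighbourhood of every periodic point. -/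
theorem IsITM.periodicMeasure_pos (hS : IsITM S) {x : Ico (0 : ℝ) 1} (hx : x ∈ periodicPts S)
    {U : Set (Ico (0 : ℝ) 1)} (hU : IsOpen U) (hxU : x ∈ U) : periodicMeasure S U ≠ 0 := by
  obtain ⟨b, hxb, hb1, hb⟩ := hS.exists_rigid_Ico hx
  obtain ⟨ε, hε, hball⟩ := Metric.isOpen_iff.1 hU x hxU
  set J : Set (Ico (0 : ℝ) 1) := {y | x ≤ y ∧ (y : ℝ) < min b (x + ε)} with hJ
  have hJsub : J ⊆ U ∩ rigidUnion S := by
    rintro y ⟨hxy, hyb⟩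
    refine ⟨hball ?_, hb ⟨hxy, hyb.trans_le (min_le_left _ _)⟩⟩
    have h1 := hyb.trans_le (min_le_right _ _)
    have h2 : (x : ℝ) ≤ y := hxy
    rw [Metric.mem_ball, Subtype.dist_eq, Real.dist_eq, abs_lt]
    constructor <;> linarith
  have hJpos : lebesgueIco J ≠ 0 := by
    rw [lebesgueIco, (MeasurableEmbedding.subtype_coe measurableSet_Ico).comap_apply]
    have : Ico (x : ℝ) (min b (x + ε)) ⊆ Subtype.val '' J := fun y hy =>
      ⟨⟨y, x.2.1.trans hy.1, (hy.2.trans_le (min_le_left _ _)).trans_le hb1⟩, hy, rfl⟩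
    refine (lt_of_lt_of_le ?_ (measure_mono this)).ne'
    rw [Real.volume_Ico, ENNReal.ofReal_pos, sub_pos]
    exact lt_min hxb (by linarith)
  rw [periodicMeasure, Measure.smul_apply, smul_eq_mul, Measure.restrict_apply hU.measurableSet]
  refine mul_ne_zero (ENNReal.inv_ne_zero.2 ?_) fun h0 => hJpos (measure_mono_null hJsub h0)
  exact ((measure_mono (subset_univ _)).trans_lt (lebesgueIco_univ ▸ ENNReal.one_lt_top)).ne

theorem measurableSet_periodicPts (hS : Measurable S) : MeasurableSet (periodicPts S) := by
  rw [← bUnion_ptsOfPeriod]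
  exact MeasurableSet.iUnion fun p => MeasurableSet.iUnion fun _ =>
    measurableSet_eq_fun (hS.iterate p) measurable_id

/-- The part of a finite invariant measure off the periodic points is invariant, because the
preimage of the set of periodic points contains it and has the same measure. -/
theorem measurePreserving_restrict_compl_periodicPts {μ : Measure (Ico (0 : ℝ) 1)}
    [IsFiniteMeasure μ] (hμ : MeasurePreserving S μ μ) :
    MeasurePreserving S (μ.restrict (periodicPts S)ᶜ) (μ.restrict (periodicPts S)ᶜ) := by
  have hP := measurableSet_periodicPts hμ.measurable
  have hsub : periodicPts S ⊆ S ⁻¹' periodicPts S := fun x hx =>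
    (bijOn_periodicPts S).mapsTo hx
  have hae : periodicPts S =ᵐ[μ] S ⁻¹' periodicPts S :=
    ae_eq_of_subset_of_measure_ge hsub (hμ.measure_preimage hP.nullMeasurableSet).le
      hP.nullMeasurableSet (measure_ne_top _ _)
  have := hμ.restrict_preimage hP.compl
  rwa [preimage_compl, ← Measure.restrict_congr_set hae.compl] at this

theorem IsITM.restrict_absolutelyContinuous (hS : IsITM S) {μ : Measure (Ico (0 : ℝ) 1)}
    [IsFiniteMeasure μ] (hμ : MeasurePreserving S μ μ) :
    μ.restrict (periodicPts S)ᶜ ≪ maximalNonatomic S :=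
  hS.absolutelyContinuous_maximalNonatomic (measurePreserving_restrict_compl_periodicPts hμ) (by
    rw [Measure.restrict_apply (measurableSet_periodicPts hμ.measurable)]; simp)

end

/-! ### Supports of invariant measures -/

theorem lemma1 (S : Ico (0 : ℝ) 1 → Ico (0 : ℝ) 1) (hS : IsITM S) :
    -- the average in the definition of the maximal non-atomic measure is a finite one
    (nonatomicErgodic S).Finite ∧
    -- the support of any invariant probability measure lies in that of the maximal measure
    (∀ μ : Measure (Ico (0 : ℝ) 1), IsProbabilityMeasure μ → MeasurePreserving S μ μ →
      μ.support ⊆ (maximalMeasure S).support) ∧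
    -- the same for non-atomic measures, off the periodic points, and the maximal non-atomic measure
    (∀ μ : Measure (Ico (0 : ℝ) 1), IsProbabilityMeasure μ → NullSingletonClass μ →
      MeasurePreserving S μ μ →
      (μ.restrict (periodicPts S)ᶜ).support ⊆ (maximalNonatomic S).support) := by
  refine ⟨hS.finite_nonatomicErgodic, fun μ _ hμ => ?_,
    fun μ _ _ hμ => (hS.restrict_absolutelyContinuous hμ).support_mono⟩
  have hac := hS.restrict_absolutelyContinuous hμ
  rw [maximalMeasure]
  split_ifs with hper
  · have h2 : maximalNonatomic S + periodicMeasure S ≪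
        (2 : ℝ≥0∞)⁻¹ • (maximalNonatomic S + periodicMeasure S) :=
      Measure.absolutelyContinuous_smul (by simp)
    refine Subset.trans ?_ h2.support_mono
    rw [Measure.support_eq_forall_isOpen, Measure.support_eq_forall_isOpen]
    intro x hx U hxU hU
    rw [Measure.add_apply]
    have hpos := hx U hxU hU
    by_cases h0 : maximalNonatomic S U = 0
    · have h1 := hac h0
      rw [Measure.restrict_apply hU.measurableSet] at h1
      -- `U` has positive measure, but only periodic points contribute to it
      obtain ⟨y, hyU, hyp⟩ : ∃ y ∈ U, y ∈ periodicPts S := by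
        by_contra! hno
        refine hpos.ne' (measure_mono_null (fun y hy => ?_) h1)
        exact ⟨hy, hno y hy⟩
      exact (pos_iff_ne_zero.2 (hS.periodicMeasure_pos hyp hU hyU)).trans_le le_add_self
    · exact (pos_iff_ne_zero.2 h0).trans_le le_self_add
  · rw [not_nonempty_iff_eq_empty] at hper
    rw [hper, compl_empty, Measure.restrict_univ] at hac
    exact hac.support_mono
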